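/- **Theorem (Hauptsatz for second order logic).** If a sequent $\Gamma\Rightarrow\Delta$ is provable in the second order sequent calculus $\mathsf{G}^1\mathsf{LC}$, then it is provable in $\mathsf{G}^1\mathsf{LC}$ without the rule $(cut)$. Here the language has no relation symbols and no function symbols. It has countably many first order variables, which are the only first order terms, and, for each $n\ge 1$, countably many $n$-ary second order variables $X^n_i$. Formulas, identified up to renaming of bound variables, are built from the atomic formulas $X^n(t_1,\dots,t_n)$ with $\lnot,\lor,\land$, first order quantifiers $\exists x,\forall x$ and second order quantifiers $\exists X^n,\forall X^n$. An $n$-ary abstract is an expression $T=\lambda x_1\dots x_n.\,G$ with $G$ an arbitrary formula and $x_1,\dots,x_n$ distinct variables; $F(T)$ is obtained from $F(X^n)$ by replacing (without capture of variables) each $X^n(t_1,\dots,t_n)$ by $G(t_1,\dots,t_n)$. A sequent $\Gamma\Rightarrow\Delta$ is a pair of finite sets of formulas, $\Gamma,\Delta$ denotes $\Gamma\cup\Delta$, and $\Gamma,A$ denotes $\Gamma\cup\{A\}$. The initial sequents of $\mathsf{G}^1\mathsf{LC}$ are $A,\Gamma\Rightarrow\Delta,A$ with $A$ atomic. The rules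 are the following (premises to the left of "$\leadsto$", conclusion to the right), with $i\in\{0,1\}$: - $\lnot F,\Gamma\Rightarrow\Delta,F\ \leadsto\ \lnot F,\Gamma\Rightarrow\Delta$; and $F,\Gamma\Rightarrow\Delta,\lnot F\ \leadsto\ \Gamma\Rightarrow\Delta,\lnot F$; - $F_0,F_0\lor F_1,\Gamma\Rightarrow\Delta$ and $F_1,F_0\lor F_1,\Gamma\Rightarrow\Delta\ \leadsto\ F_0\lor F_1,\Gamma\Rightarrow\Delta$; and $\Gamma\Rightarrow\Delta,F_0\lor F_1,F_i\ \leadsto\ \Gamma\Rightarrow\Delta,F_0\lor F_1$; - $F_i,F_0\land F_1,\Gamma\Rightarrow\Delta\ \leadsto\ F_0\land F_1,\Gamma\Rightarrow\Delta$; and $\Gamma\Rightarrow\Delta,F_0\land F_1,F_0$ and $\Gamma\Rightarrow\Delta,F_0\land F_1,F_1\ \leadsto\ \Gamma\Rightarrow\Delta,F_0\land F_1$; - $F(a),\exists xF(x),\Gamma\Rightarrow\Delta\ \leadsto\ \exists xF(x),\Gamma\Rightarrow\Delta$; and $\Gamma\Rightarrow\Delta,\exists xF(x),F(t)\ \leadsto\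 \Gamma\Rightarrow\Delta,\exists xF(x)$; - $F(t),\forall xF(x),\Gamma\Rightarrow\Delta\ \leadsto\ \forall xF(x),\Gamma\Rightarrow\Delta$; and $\Gamma\Rightarrow\Delta,\forall xF(x),F(a)\ \leadsto\ \Gamma\Rightarrow\Delta,\forall xF(x)$; - $F(Y),\exists X^nF(X),\Gamma\Rightarrow\Delta\ \leadsto\ \exists X^nF(X),\Gamma\Rightarrow\Delta$; and $\Gamma\Rightarrow\Delta,\exists X^nF(X),F(T)\ \leadsto\ \Gamma\Rightarrow\Delta,\exists X^nF(X)$; - $F(T),\forall X^nF(X),\Gamma\Rightarrow\Delta\ \leadsto\ \forall X^nF(X),\Gamma\Rightarrow\Delta$; and $\Gamma\Rightarrow\Delta,\forall X^nF(X),F(Y)\ \leadsto\ \Gamma\Rightarrow\Delta,\forall X^nF(X)$; - $(cut)$: $\Gamma\Rightarrow\Delta,C$ and $C,\Pi\Rightarrow\Theta\ \leadsto\ \Gamma,\Pi\Rightarrow\Delta,\Theta$. Here $t$ is any first order term, $T$ any $n$-ary abstract, and the eigenvariables $a$ (first order) and $Y$ ($n$-ary second order) must not occur free in the conclusion of the rule.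 -/

import Mathlib

/-! Second order sequent calculus (with and without cut) over the language that has no relation
symbols and no function symbols.

There are countably many first order variables `0, 1, 2, …` and, for every `n : ℕ`, countably many
second order variables of arity `n + 1` (so the arities are `1, 2, 3, …`).  Since there are no
function symbols, the first order terms are exactly the first order variables.

Formulas up to renaming of bound variables are represented by de Bruijn indices: below a quantifier
the index `0` of the sort (and, for second order quantifiers, of the arity) in question is the bound
variable and the index `i + 1` stands for what is `i` outside of it.  Indices that are not captured
by a quantifier are the free variables. -/

namespace G1LC

/-- Second order formulas, up to renaming of bound variables. -/
inductive Formula : Type where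
  /-- `atom n X t` is `X(t₁, …, tₙ₊₁)` for the `X`-th second order variable of arity `n + 1`. -/
  | atom (n : ℕ) (X : ℕ) (t : Fin (n + 1) → ℕ) : Formula
  | neg (F : Formula) : Formula
  | or (F G : Formula) : Formula
  | and (F G : Formula) : Formula
  /-- `∃ x F`, first order. -/
  | ex0 (F : Formula) : Formula
  /-- `∀ x F`, first order. -/
  | all0 (F : Formula) : Formula
  /-- `∃ X F` for a second order variable `X` of arity `n + 1`. -/
  | ex1 (n : ℕ) (F : Formula) : Formula
  /-- `∀ X F` for a second order variable `X` of arity `n + 1`. -/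
  | all1 (n : ℕ) (F : Formula) : Formula

noncomputable instance : DecidableEq Formula := Classical.decEq _

/-- Pass the map `f` of indices below `k` binders. -/
def liftMap (k : ℕ) (f : ℕ → ℕ) (i : ℕ) : ℕ := if i < k then i else f (i - k) + k

/-- Pass the map `g` of second order indices (`g n` acts on the indices of arity `n + 1`) below a
quantifier over second order variables of arity `k + 1`. -/
def liftMap1 (k : ℕ) (g : ℕ → ℕ → ℕ) (n : ℕ) : ℕ → ℕ := if n = k then liftMap 1 (g n) else g n

/-- The second order indices of arity `k + 1` are increased by one, the others stay. -/
def shift1 (k n i : ℕ) : ℕ := if n = k then i + 1 else i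

namespace Formula

/-- Replace simultaneously the free first order variables `i` by `f i`, avoiding capture. -/
def rename0 : (ℕ → ℕ) → Formula → Formula
  | f, atom n X t => atom n X (fun j => f (t j))
  | f, neg F => neg (rename0 f F)
  | f, or F G => or (rename0 f F) (rename0 f G)
  | f, and F G => and (rename0 f F) (rename0 f G)
  | f, ex0 F => ex0 (rename0 (liftMap 1 f) F)
  | f, all0 F => all0 (rename0 (liftMap 1 f) F)
  | f, ex1 n F => ex1 n (rename0 f F)
  | f, all1 n F => all1 n (rename0 f F)

/-- Replace simultaneously the free second order variables `i` of arity `n + 1` by `g n i`,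
avoiding capture. -/
def rename1 : (ℕ → ℕ → ℕ) → Formula → Formula
  | g, atom n X t => atom n (g n X) t
  | g, neg F => neg (rename1 g F)
  | g, or F G => or (rename1 g F) (rename1 g G)
  | g, and F G => and (rename1 g F) (rename1 g G)
  | g, ex0 F => ex0 (rename1 g F)
  | g, all0 F => all0 (rename1 g F)
  | g, ex1 n F => ex1 n (rename1 (liftMap1 n g) F)
  | g, all1 n F => all1 n (rename1 (liftMap1 n g) F)

/-- The first order variable `a` occurs free in the formula. -/
def Occurs0 : ℕ → Formula → Prop
  | a, atom _ _ t => ∃ j, t j = a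
  | a, neg F => Occurs0 a F
  | a, or F G => Occurs0 a F ∨ Occurs0 a G
  | a, and F G => Occurs0 a F ∨ Occurs0 a G
  | a, ex0 F => Occurs0 (a + 1) F
  | a, all0 F => Occurs0 (a + 1) F
  | a, ex1 _ F => Occurs0 a F
  | a, all1 _ F => Occurs0 a F

/-- `Occurs1 n Y F`: the second order variable `Y` of arity `n + 1` occurs free in `F`. -/
def Occurs1 (n : ℕ) : ℕ → Formula → Prop
  | Y, atom m X _ => m = n ∧ X = Y
  | Y, neg F => Occurs1 n Y F
  | Y, or F G => Occurs1 n Y F ∨ Occurs1 n Y G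
  | Y, and F G => Occurs1 n Y F ∨ Occurs1 n Y G
  | Y, ex0 F => Occurs1 n Y F
  | Y, all0 F => Occurs1 n Y F
  | Y, ex1 k F => Occurs1 n (shift1 k n Y) F
  | Y, all1 k F => Occurs1 n (shift1 k n Y) F

/-- `F(t)`, where `F` is the body of a first order quantifier and `t` a first order term. -/
def inst0 (F : Formula) (t : ℕ) : Formula :=
  rename0 (fun i => if i = 0 then t else i - 1) F

end Formula

open Formula

/-- The `(n + 1)`-ary abstracts `λ x₁ … xₙ₊₁. G`, given by their body `G`, in which the first order
indices `0, …, n` stand for `x₁, …, xₙ₊₁` and the index `i + (n + 1)` stands for the free first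
order variable `i`. -/
abbrev Abstract (_n : ℕ) : Type := Formula

namespace Abstract

/-- `(λ x₁ … xₙ₊₁. G)(t₁, …, tₙ₊₁) ≡ G(t₁, …, tₙ₊₁)`. -/
def app {n : ℕ} (G : Abstract n) (t : Fin (n + 1) → ℕ) : Formula :=
  rename0 (fun i => if h : i < n + 1 then t ⟨i, h⟩ else i - (n + 1)) G

/-- The abstract `λ x₁ … xₙ₊₁. Y(x₁, …, xₙ₊₁)`, that is, the second order variable `Y` itself. -/
def var (n Y : ℕ) : Abstract n := atom n Y (fun j => j)

/-- The abstract, read below one more first order quantifier. -/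
def weaken0 {n : ℕ} (G : Abstract n) : Abstract n := rename0 (liftMap (n + 1) (· + 1)) G

/-- The abstract, read below one more quantifier over second order variables of arity `k + 1`. -/
def weaken1 (k : ℕ) {n : ℕ} (G : Abstract n) : Abstract n := rename1 (shift1 k) G

end Abstract

/-- A simultaneous second order substitution: an abstract for each second order variable. -/
abbrev Subst : Type := (n : ℕ) → ℕ → Abstract n

/-- Pass a substitution below a quantifier over second order variables of arity `k + 1`. -/
def Subst.lift1 (k : ℕ) (σ : Subst) : Subst := fun n i =>
  if n = k then
    if i = 0 then Abstract.var n 0 else (σ n (i - 1)).weaken1 k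
  else (σ n i).weaken1 k

namespace Formula

/-- Replace simultaneously all atomic formulas `X(t₁, …)` with `X` free by `σ(X)(t₁, …)`,
avoiding capture. -/
def subst : Subst → Formula → Formula
  | σ, atom n X t => (σ n X).app t
  | σ, neg F => neg (subst σ F)
  | σ, or F G => or (subst σ F) (subst σ G)
  | σ, and F G => and (subst σ F) (subst σ G)
  | σ, ex0 F => ex0 (subst (fun n i => (σ n i).weaken0) F)
  | σ, all0 F => all0 (subst (fun n i => (σ n i).weaken0) F)
  | σ, ex1 k F => ex1 k (subst (σ.lift1 k) F)
  | σ, all1 k F => all1 k (subst (σ.lift1 k) F)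

/-- `F(T)`, where `F` is the body of a quantifier over second order variables of arity `k + 1` and
`T` is a `(k + 1)`-ary abstract. -/
def inst1 {k : ℕ} (F : Formula) (T : Abstract k) : Formula :=
  subst (fun n i =>
    if n = k then
      if i = 0 then T else Abstract.var n (i - 1)
    else Abstract.var n i) F

end Formula

/-- Cedents are finite sets of formulas. -/
abbrev Cedent : Type := Finset Formula

/-- `Derivable c Γ Δ`: the sequent `Γ ⇒ Δ` has a derivation, in which the rule `(cut)` may be used
if `c = true` and may not be used if `c = false`. -/
inductive Derivable (c : Bool) : Cedent → Cedent → Prop where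
  | init (Γ Δ : Cedent) (n X : ℕ) (t : Fin (n + 1) → ℕ) :
      Derivable c (insert (atom n X t) Γ) (insert (atom n X t) Δ)
  | negL (Γ Δ : Cedent) (F : Formula) :
      Derivable c (insert (neg F) Γ) (insert F Δ) →
      Derivable c (insert (neg F) Γ) Δ
  | negR (Γ Δ : Cedent) (F : Formula) :
      Derivable c (insert F Γ) (insert (neg F) Δ) →
      Derivable c Γ (insert (neg F) Δ)
  | orL (Γ Δ : Cedent) (F G : Formula) :
      Derivable c (insert F (insert (or F G) Γ)) Δ →
      Derivable c (insert G (insert (or F G) Γ)) Δ →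
      Derivable c (insert (or F G) Γ) Δ
  | orR₀ (Γ Δ : Cedent) (F G : Formula) :
      Derivable c Γ (insert F (insert (or F G) Δ)) →
      Derivable c Γ (insert (or F G) Δ)
  | orR₁ (Γ Δ : Cedent) (F G : Formula) :
      Derivable c Γ (insert G (insert (or F G) Δ)) →
      Derivable c Γ (insert (or F G) Δ)
  | andL₀ (Γ Δ : Cedent) (F G : Formula) :
      Derivable c (insert F (insert (and F G) Γ)) Δ →
      Derivable c (insert (and F G) Γ) Δ
  | andL₁ (Γ Δ : Cedent) (F G : Formula) :
      Derivable c (insert G (insert (and F G) Γ)) Δ →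
      Derivable c (insert (and F G) Γ) Δ
  | andR (Γ Δ : Cedent) (F G : Formula) :
      Derivable c Γ (insert F (insert (and F G) Δ)) →
      Derivable c Γ (insert G (insert (and F G) Δ)) →
      Derivable c Γ (insert (and F G) Δ)
  | ex0L (Γ Δ : Cedent) (F : Formula) (a : ℕ) :
      (∀ B ∈ insert (ex0 F) Γ ∪ Δ, ¬ Occurs0 a B) →
      Derivable c (insert (inst0 F a) (insert (ex0 F) Γ)) Δ →
      Derivable c (insert (ex0 F) Γ) Δ
  | ex0R (Γ Δ : Cedent) (F : Formula) (t : ℕ) :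
      Derivable c Γ (insert (inst0 F t) (insert (ex0 F) Δ)) →
      Derivable c Γ (insert (ex0 F) Δ)
  | all0L (Γ Δ : Cedent) (F : Formula) (t : ℕ) :
      Derivable c (insert (inst0 F t) (insert (all0 F) Γ)) Δ →
      Derivable c (insert (all0 F) Γ) Δ
  | all0R (Γ Δ : Cedent) (F : Formula) (a : ℕ) :
      (∀ B ∈ Γ ∪ insert (all0 F) Δ, ¬ Occurs0 a B) →
      Derivable c Γ (insert (inst0 F a) (insert (all0 F) Δ)) →
      Derivable c Γ (insert (all0 F) Δ)
  | ex1L (Γ Δ : Cedent) (n : ℕ) (F : Formula) (Y : ℕ) :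
      (∀ B ∈ insert (ex1 n F) Γ ∪ Δ, ¬ Occurs1 n Y B) →
      Derivable c (insert (inst1 F (Abstract.var n Y)) (insert (ex1 n F) Γ)) Δ →
      Derivable c (insert (ex1 n F) Γ) Δ
  | ex1R (Γ Δ : Cedent) (n : ℕ) (F : Formula) (T : Abstract n) :
      Derivable c Γ (insert (inst1 F T) (insert (ex1 n F) Δ)) →
      Derivable c Γ (insert (ex1 n F) Δ)
  | all1L (Γ Δ : Cedent) (n : ℕ) (F : Formula) (T : Abstract n) :
      Derivable c (insert (inst1 F T) (insert (all1 n F) Γ)) Δ →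
      Derivable c (insert (all1 n F) Γ) Δ
  | all1R (Γ Δ : Cedent) (n : ℕ) (F : Formula) (Y : ℕ) :
      (∀ B ∈ Γ ∪ insert (all1 n F) Δ, ¬ Occurs1 n Y B) →
      Derivable c Γ (insert (inst1 F (Abstract.var n Y)) (insert (all1 n F) Δ)) →
      Derivable c Γ (insert (all1 n F) Δ)
  | cut (Γ Δ Γ₁ Δ₁ : Cedent) (C : Formula) :
      c = true →
      Derivable c Γ (insert C Δ) →
      Derivable c (insert C Γ₁) Δ₁ →
      Derivable c (Γ ∪ Γ₁) (Δ ∪ Δ₁)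

/-- The sequent `Γ ⇒ Δ` is provable in the second order calculus with cut. -/
def Provable (Γ Δ : Cedent) : Prop := Derivable true Γ Δ

/-- The sequent `Γ ⇒ Δ` is provable in the second order calculus without cut. -/
def CutFreeProvable (Γ Δ : Cedent) : Prop := Derivable false Γ Δ

end G1LC

namespace G1LC

open Formula

/-! ### Syntactic substitution lemmas -/

/-! The proof is semantic: forcing with sequents, combined with reducibility candidates. Conditions
are sequents ordered by inclusion, and cut-free provability plays the role of falsity, so `compl` is
negation and the sets with `compl (compl X) ⊆ X` are the classical propositions. A candidate for a
formula `A` is such a proposition, closed under extension, that holds wherever `A` stands in the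
antecedent and that is refuted wherever `A` stands in the succedent.

Formulas are evaluated by the usual clauses, except that a second order quantifier ranges only over
predicates whose values are candidates for the instances of some abstract. `candidate_value` shows
that the value of a formula is then a candidate for the corresponding substitution instance; each
connective uses exactly its own two cut-free rules. The range of the quantifiers is defined without
reference to values of formulas, which avoids the circularity of impredicative comprehension.
Comprehension itself comes afterwards, in `isCandidate_value`: an abstract defines an admissible
predicate because its values are candidates for its own instances.

`Derivable.cutFree_of_forces` is soundness, with cut included: a condition forcing the antecedent
and the negations of the succedent of a derivable sequent is itself provable without cut. When every
second order variable is interpreted by itself, the two defining properties of candidates say that a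
sequent forces its own antecedent and the negations of its own succedent, and the theorem follows.
-/

theorem liftMap_comp (k : ℕ) (f g : ℕ → ℕ) :
    (fun i => liftMap k f (liftMap k g i)) = liftMap k (fun i => f (g i)) := by
  funext i
  unfold liftMap
  by_cases h : i < k <;> simp [h]

theorem liftMap_id (k : ℕ) : liftMap k (fun i => i) = fun i => i := by
  funext i
  change (if i < k then i else i - k + k) = i
  split <;> omega

theorem liftMap_add (k : ℕ) (f : ℕ → ℕ) (i : ℕ) : liftMap k f (i + k) = f i + k := by
  simp [liftMap]

/-- Prepend a finite tuple to a sequence. -/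
def consTuple {k : ℕ} (t : Fin k → ℕ) (ρ : ℕ → ℕ) (i : ℕ) : ℕ :=
  if h : i < k then t ⟨i, h⟩ else ρ (i - k)

/-- Prepend an entry to a sequence. -/
def cons (a : ℕ) (ρ : ℕ → ℕ) (i : ℕ) : ℕ := if i = 0 then a else ρ (i - 1)

theorem consTuple_liftMap {k : ℕ} (t : Fin k → ℕ) (ρ f : ℕ → ℕ) :
    (fun i => consTuple t ρ (liftMap k f i)) = consTuple t (fun i => ρ (f i)) := by
  funext i
  unfold liftMap consTuple
  by_cases h : i < k <;> simp [h]

theorem cons_liftMap (a : ℕ) (ρ f : ℕ → ℕ) :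
    (fun i => cons a ρ (liftMap 1 f i)) = cons a (fun i => ρ (f i)) := by
  funext i
  unfold liftMap cons
  by_cases h : i = 0 <;> simp [h]

theorem consTuple_fin {k : ℕ} (t : Fin k → ℕ) (ρ : ℕ → ℕ) (j : Fin k) :
    consTuple t ρ j = t j := by
  simp [consTuple]

theorem consTuple_add {k : ℕ} (t : Fin k → ℕ) (ρ : ℕ → ℕ) (i : ℕ) :
    consTuple t ρ (i + k) = ρ i := by
  simp [consTuple]

theorem comp_consTuple {k : ℕ} (f : ℕ → ℕ) (t : Fin k → ℕ) (ρ : ℕ → ℕ) :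
    (fun i => f (consTuple t ρ i)) = consTuple (fun j => f (t j)) (fun i => f (ρ i)) := by
  funext i
  unfold consTuple
  split <;> rfl

theorem Abstract.app_eq {n : ℕ} (G : Abstract n) (t : Fin (n + 1) → ℕ) :
    G.app t = rename0 (consTuple t (fun i => i)) G := rfl

theorem inst0_eq (F : Formula) (t : ℕ) : inst0 F t = rename0 (cons t (fun i => i)) F := rfl

@[simp] theorem Abstract.app_var (n Y : ℕ) (t : Fin (n + 1) → ℕ) :
    (Abstract.var n Y).app t = atom n Y t := by
  simp [Abstract.app_eq, Abstract.var, rename0, consTuple_fin]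

namespace Formula

theorem rename0_rename0 (F : Formula) : ∀ f g : ℕ → ℕ,
    rename0 f (rename0 g F) = rename0 (fun i => f (g i)) F := by
  induction F <;> intro f g <;> simp_all [rename0, liftMap_comp]

theorem rename0_id (F : Formula) : rename0 (fun i => i) F = F := by
  induction F <;> simp_all [rename0, liftMap_id]

theorem rename0_rename1 (F : Formula) : ∀ (f : ℕ → ℕ) (g : ℕ → ℕ → ℕ),
    rename0 f (rename1 g F) = rename1 g (rename0 f F) := by
  induction F <;> intro f g <;> simp_all [rename0, rename1]

theorem liftMap1_comp (k : ℕ) (f g : ℕ → ℕ → ℕ) :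
    (fun n i => liftMap1 k f n (liftMap1 k g n i)) = liftMap1 k (fun n i => f n (g n i)) := by
  funext n i
  unfold liftMap1
  by_cases h : n = k
  · simpa [h] using congrFun (liftMap_comp 1 (f k) (g k)) i
  · simp [h]

theorem rename1_rename1 (F : Formula) : ∀ f g : ℕ → ℕ → ℕ,
    rename1 f (rename1 g F) = rename1 (fun n i => f n (g n i)) F := by
  induction F <;> intro f g <;> simp_all [rename1, liftMap1_comp]

end Formula

theorem liftMap1_shift1 (k : ℕ) (g : ℕ → ℕ → ℕ) (n i : ℕ) :
    liftMap1 k g n (shift1 k n i) = shift1 k n (g n i) := by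
  unfold liftMap1 shift1 liftMap
  by_cases h : n = k <;> simp [h]

namespace Subst

/-- Rename the free first order variables of all abstracts of a substitution. -/
def rename0 (f : ℕ → ℕ) (σ : Subst) : Subst := fun n i =>
  Formula.rename0 (liftMap (n + 1) f) (σ n i)

theorem rename0_rename0 (f g : ℕ → ℕ) (σ : Subst) :
    (σ.rename0 g).rename0 f = σ.rename0 (fun i => f (g i)) := by
  funext n i
  simp [rename0, Formula.rename0_rename0, liftMap_comp]

theorem rename0_id (σ : Subst) : σ.rename0 (fun i => i) = σ := by
  funext n i
  simp [rename0, Formula.rename0_id, liftMap_id]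

/-- The substitution that leaves all second order variables fixed. -/
def id : Subst := fun n i => Abstract.var n i

theorem rename0_var (f : ℕ → ℕ) (n i : ℕ) :
    Formula.rename0 (liftMap (n + 1) f) (Abstract.var n i) = Abstract.var n i := by
  simp only [Abstract.var, Formula.rename0, liftMap, Fin.is_lt, if_true]

theorem rename0_id_left (f : ℕ → ℕ) : Subst.id.rename0 f = Subst.id := by
  funext n i
  exact rename0_var f n i

theorem lift1_rename0 (k : ℕ) (f : ℕ → ℕ) (σ : Subst) :
    (σ.rename0 f).lift1 k = (σ.lift1 k).rename0 f := by
  funext n i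
  by_cases h : n = k
  · by_cases hi : i = 0
    · subst h hi
      simp [lift1, rename0, rename0_var]
    · simp [lift1, rename0, Abstract.weaken1, h, hi, rename0_rename1]
  · simp [lift1, rename0, Abstract.weaken1, h, rename0_rename1]

theorem lift1_id (k : ℕ) : Subst.id.lift1 k = Subst.id := by
  funext n i
  unfold lift1 id Abstract.weaken1 Abstract.var shift1
  by_cases h : n = k
  · by_cases hi : i = 0
    · simp [h, hi]
    · simp only [h, hi, rename1, if_true, if_false]
      congr 1
      omega
  · simp [h, rename1]

theorem lift1_shift1 (k : ℕ) (σ : Subst) (n i : ℕ) :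
    σ.lift1 k n (shift1 k n i) = (σ n i).weaken1 k := by
  unfold lift1 shift1
  by_cases h : n = k <;> simp [h]

end Subst

namespace Formula

theorem rename0_app {n : ℕ} (f : ℕ → ℕ) (G : Abstract n) (t : Fin (n + 1) → ℕ) :
    rename0 f (G.app t) =
      Abstract.app (n := n) (rename0 (liftMap (n + 1) f) G) (fun j => f (t j)) := by
  simp [Abstract.app_eq, rename0_rename0, consTuple_liftMap, comp_consTuple]

theorem weaken0_eq (σ : Subst) : (fun n i => (σ n i).weaken0) = σ.rename0 (· + 1) := rfl

theorem rename0_subst (F : Formula) : ∀ (f : ℕ → ℕ) (σ : Subst),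
    rename0 f (subst σ F) = subst (σ.rename0 f) (rename0 f F) := by
  have key : ∀ (f : ℕ → ℕ) (σ : Subst), (σ.rename0 (· + 1)).rename0 (liftMap 1 f) =
      (σ.rename0 f).rename0 (· + 1) := by
    intro f σ
    rw [Subst.rename0_rename0, Subst.rename0_rename0]
    congr 1
  induction F with
  | atom n X t => intro f σ; exact rename0_app _ _ _
  | _ => intro f σ; simp_all [rename0, subst, weaken0_eq, Subst.lift1_rename0]

theorem subst_id (F : Formula) : subst Subst.id F = F := by
  induction F with
  | atom n X t => exact Abstract.app_var n X t
  | _ => simp_all [subst, weaken0_eq, Subst.rename0_id_left, Subst.lift1_id]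

theorem subst_rename1 (F : Formula) : ∀ (τ : Subst) (g : ℕ → ℕ → ℕ),
    subst τ (rename1 g F) = subst (fun n i => τ n (g n i)) F := by
  have key : ∀ (k : ℕ) (τ : Subst) (g : ℕ → ℕ → ℕ),
      (fun n i => τ.lift1 k n (liftMap1 k g n i)) = Subst.lift1 k (fun n i => τ n (g n i)) := by
    intro k τ g
    funext n i
    unfold Subst.lift1 liftMap1 liftMap
    by_cases h : n = k
    · by_cases hi : i = 0 <;> simp [h, hi]
    · simp [h]
  induction F with
  | atom n X t => intro τ g; rfl
  | _ => intro τ g; simp_all [rename1, subst]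

theorem rename1_subst (F : Formula) : ∀ (g : ℕ → ℕ → ℕ) (τ : Subst),
    rename1 g (subst τ F) = subst (fun n i => rename1 g (τ n i)) F := by
  have key : ∀ (k : ℕ) (τ : Subst) (g : ℕ → ℕ → ℕ),
      (fun n i => rename1 (liftMap1 k g) (τ.lift1 k n i)) =
        Subst.lift1 k (fun n i => rename1 g (τ n i)) := by
    intro k τ g
    funext n i
    unfold Subst.lift1 Abstract.weaken1
    by_cases h : n = k
    · by_cases hi : i = 0
      · simp [h, hi, Abstract.var, rename1, liftMap1, liftMap]
      · simp [h, hi, rename1_rename1, liftMap1_shift1]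
    · simp [h, rename1_rename1, liftMap1_shift1]
  induction F with
  | atom n X t => intro g τ; exact (rename0_rename1 _ _ _).symm
  | ex0 F ih | all0 F ih =>
    intro g τ; simp [rename1, subst, ih, Abstract.weaken0, rename0_rename1]
  | _ => intro g τ; simp_all [rename1, subst]

end Formula

/-! ### Composition of second order substitutions -/

namespace Subst

/-- First `σ`, then `τ`. -/
def comp (σ τ : Subst) : Subst := fun n i => subst (τ.rename0 (· + (n + 1))) (σ n i)

theorem comp_rename0 (f : ℕ → ℕ) (σ τ : Subst) :
    (σ.comp τ).rename0 f = (σ.rename0 f).comp (τ.rename0 f) := by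
  funext n i
  have : (fun i => liftMap (n + 1) f (i + (n + 1))) = fun i => f i + (n + 1) := by
    funext i
    exact liftMap_add _ _ _
  simp only [comp, rename0, rename0_subst]
  change subst ((τ.rename0 _).rename0 _) _ = subst ((τ.rename0 _).rename0 _) _
  rw [rename0_rename0, rename0_rename0, this]

/-- The shift by `n + 1` keeps the indices of `τ` clear of the argument places `0, …, n` of the
surrounding abstract; applying the result to exactly these arguments undoes the shift. -/
theorem comp_var (τ : Subst) (n i : ℕ) :
    subst (τ.rename0 (· + (n + 1))) (Abstract.var n i) = τ n i := by
  change Abstract.app (n := n) (τ.rename0 (· + (n + 1)) n i) _ = _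
  rw [Abstract.app_eq, rename0, Formula.rename0_rename0, consTuple_liftMap]
  convert Formula.rename0_id _ using 2
  funext i
  unfold consTuple
  split
  · rfl
  · change i - (n + 1) + (n + 1) = i
    omega

theorem comp_lift1 (k : ℕ) (σ τ : Subst) :
    (σ.lift1 k).comp (τ.lift1 k) = (σ.comp τ).lift1 k := by
  have key : ∀ n (G : Abstract n), subst ((τ.lift1 k).rename0 (· + (n + 1))) (G.weaken1 k) =
      Abstract.weaken1 k (n := n) (subst (τ.rename0 (· + (n + 1))) G) := by
    intro n G
    rw [← lift1_rename0, Abstract.weaken1, Abstract.weaken1, subst_rename1, rename1_subst]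
    simp only [lift1_shift1, Abstract.weaken1]
  funext n i
  by_cases h : n = k
  · by_cases hi : i = 0
    · subst h hi
      have hσ : σ.lift1 n n 0 = Abstract.var n 0 := by simp [lift1]
      rw [comp, hσ, comp_var]
      simp [lift1]
    · subst h
      simpa [comp, lift1, hi] using key n (σ n (i - 1))
  · simpa [comp, lift1, h] using key n (σ n i)

end Subst

namespace Formula

theorem subst_app {n : ℕ} (τ : Subst) (G : Abstract n) (t : Fin (n + 1) → ℕ) :
    subst τ (G.app t) = Abstract.app (n := n) (subst (τ.rename0 (· + (n + 1))) G) t := by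
  rw [Abstract.app_eq, Abstract.app_eq, rename0_subst, Subst.rename0_rename0]
  congr 1
  simp only [consTuple_add, Subst.rename0_id]

theorem subst_subst (F : Formula) : ∀ σ τ : Subst,
    subst τ (subst σ F) = subst (σ.comp τ) F := by
  induction F with
  | atom n X t => intro σ τ; exact subst_app _ _ _
  | _ => intro σ τ; simp_all [subst, weaken0_eq, Subst.comp_rename0, Subst.comp_lift1]

end Formula

/-- Extend a substitution by an abstract for a new second order variable of arity `k + 1`. -/
def Subst.push (k : ℕ) (T : Abstract k) (σ : Subst) : Subst := fun n i =>
  if n = k then if i = 0 then T else σ n (i - 1) else σ n i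

/-- Abstracts passed below the quantifier are weakened, so they do not mention the new variable, and
substituting `T` for it restores them. -/
theorem Subst.lift1_comp_push (k : ℕ) (T : Abstract k) (σ : Subst) :
    (σ.lift1 k).comp (Subst.push k T Subst.id) = σ.push k T := by
  have key : ∀ n (G : Abstract n),
      subst ((Subst.push k T Subst.id).rename0 (· + (n + 1))) (G.weaken1 k) = G := by
    intro n G
    rw [Abstract.weaken1, subst_rename1]
    convert subst_id G using 2
    funext m i
    by_cases h : m = k
    · subst h
      simp only [rename0, push, shift1, if_true, Nat.add_eq_zero_iff, one_ne_zero, and_false,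
        if_false, Nat.add_sub_cancel]
      exact rename0_var _ m i
    · simp only [rename0, push, shift1, h, if_false]
      exact rename0_var _ m i
  funext n i
  by_cases h : n = k
  · by_cases hi : i = 0
    · subst h hi
      simpa [lift1, comp, push] using comp_var (push n T Subst.id) n 0
    · subst h
      simpa [comp, lift1, push, hi] using key n (σ n (i - 1))
  · simpa [comp, lift1, push, h] using key n (σ n i)

/-- Identifies the active formula of a second order rule, applied to a substituted quantified
formula, with the instance of the body to which the induction hypothesis of `candidate_value`
applies. -/
theorem inst1_subst_lift1 (k : ℕ) (T : Abstract k) (σ : Subst) (F : Formula) :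
    inst1 (subst (σ.lift1 k) F) T = subst (σ.push k T) F := by
  change subst (Subst.push k T Subst.id) _ = _
  rw [subst_subst, Subst.lift1_comp_push]

theorem rename0_subst_weaken {m : ℕ} (f g : ℕ → ℕ) (σ : Subst) (F : Formula)
    (h : ∀ i, f (i + m) = i) :
    rename0 f (subst (σ.rename0 (· + m)) (rename0 g F)) =
      subst σ (rename0 (fun i => f (g i)) F) := by
  rw [rename0_subst, rename0_rename0, Subst.rename0_rename0]
  simp only [h, Subst.rename0_id]

theorem inst0_subst_weaken0 (a : ℕ) (ρ : ℕ → ℕ) (σ : Subst) (F : Formula) :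
    inst0 (subst (fun n i => (σ n i).weaken0) (rename0 (liftMap 1 ρ) F)) a =
      subst σ (rename0 (cons a ρ) F) := by
  rw [weaken0_eq, inst0_eq, rename0_subst_weaken _ _ _ _ (by simp [cons]), cons_liftMap]

theorem app_subst_weaken {n : ℕ} (t : Fin (n + 1) → ℕ) (ρ : ℕ → ℕ) (σ : Subst)
    (G : Abstract n) :
    Abstract.app (n := n) (subst (σ.rename0 (· + (n + 1))) (rename0 (liftMap (n + 1) ρ) G)) t =
      subst σ (rename0 (consTuple t ρ) G) := by
  rw [Abstract.app_eq, rename0_subst_weaken _ _ _ _ (consTuple_add _ _), consTuple_liftMap]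

/-! ### Fresh variables -/

/-- A bound beyond which every variable is fresh, rather than one fresh variable, survives the index
shift at binders and can be taken uniformly over a finite set of formulas. -/
theorem Formula.exists_bound_occurs0 (F : Formula) : ∃ N, ∀ a ≥ N, ¬ Occurs0 a F := by
  induction F with
  | atom n X t =>
    refine ⟨(Finset.univ.sup t) + 1, fun a ha ⟨j, hj⟩ => ?_⟩
    have := Finset.le_sup (f := t) (Finset.mem_univ j)
    omega
  | neg F ih | ex1 _ F ih | all1 _ F ih => exact ih
  | or F G ih ih' | and F G ih ih' =>
    obtain ⟨N, hN⟩ := ih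
    obtain ⟨M, hM⟩ := ih'
    exact ⟨N + M, fun a ha h => h.elim (hN a (by omega)) (hM a (by omega))⟩
  | ex0 F ih | all0 F ih =>
    obtain ⟨N, hN⟩ := ih
    exact ⟨N, fun a ha h => hN (a + 1) (by omega) h⟩

theorem Formula.exists_bound_occurs1 (n : ℕ) (F : Formula) :
    ∃ N, ∀ Y ≥ N, ¬ Occurs1 n Y F := by
  induction F with
  | atom m X t =>
    refine ⟨X + 1, fun a ha h => ?_⟩
    have := h.2
    omega
  | neg F ih | ex0 F ih | all0 F ih => exact ih
  | or F G ih ih' | and F G ih ih' =>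
    obtain ⟨N, hN⟩ := ih
    obtain ⟨M, hM⟩ := ih'
    exact ⟨N + M, fun a ha h => h.elim (hN a (by omega)) (hM a (by omega))⟩
  | ex1 k F ih | all1 k F ih =>
    obtain ⟨N, hN⟩ := ih
    refine ⟨N, fun a ha h => hN (shift1 k n a) ?_ h⟩
    unfold shift1
    split <;> omega

theorem exists_fresh (P : ℕ → Formula → Prop) (hP : ∀ F, ∃ N, ∀ a ≥ N, ¬ P a F) (S : Cedent) :
    ∃ a, ∀ B ∈ S, ¬ P a B := by
  choose N hN using hP
  exact ⟨S.sup N, fun B hB => hN B _ (Finset.le_sup hB)⟩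

/-! ### Forcing with sequents -/

/-- Sequents, ordered by inclusion of both cedents. -/
abbrev Sequent : Type := Cedent × Cedent

/-- The sequent is provable without cut. -/
def CutFree (s : Sequent) : Prop := CutFreeProvable s.1 s.2

/-- The sequents no extension of which is in `X`, unless it is provable without cut. -/
def compl (X : Set Sequent) : Set Sequent := {s | ∀ t, s ≤ t → t ∈ X → CutFree t}

theorem isUpperSet_compl (X : Set Sequent) : IsUpperSet (compl X) :=
  fun _ _ hst hs _ htu hu => hs _ (hst.trans htu) hu

theorem subset_compl_compl {X : Set Sequent} (hX : IsUpperSet X) : X ⊆ compl (compl X) :=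
  fun _ hs t hst ht => ht t le_rfl (hX hst hs)

/-- Negation reverses the inclusion of `X` in its double negation. Hence every value of the form
`compl X` with `X` upper is automatically closed; only conjunctions and universal quantifiers must
inherit closure from their components. -/
theorem compl_compl_compl_subset {X : Set Sequent} (hX : IsUpperSet X) :
    compl (compl (compl X)) ⊆ compl X :=
  fun _ hs t hst ht => hs t hst (subset_compl_compl hX ht)

/-- `X` is a possible value of the formula `A`. -/
structure Candidate (A : Formula) (X : Set Sequent) : Prop where
  upper : IsUpperSet X
  closed : compl (compl X) ⊆ X
  left : ∀ s : Sequent, A ∈ s.1 → s ∈ X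
  right : ∀ s : Sequent, A ∈ s.2 → s ∈ X → CutFree s

/-- Add a formula to the antecedent. -/
noncomputable def addL (A : Formula) (s : Sequent) : Sequent := (insert A s.1, s.2)

/-- Add a formula to the succedent. -/
noncomputable def addR (A : Formula) (s : Sequent) : Sequent := (s.1, insert A s.2)

theorem le_addL (A : Formula) (s : Sequent) : s ≤ addL A s :=
  ⟨Finset.subset_insert _ _, le_rfl⟩

theorem le_addR (A : Formula) (s : Sequent) : s ≤ addR A s :=
  ⟨le_rfl, Finset.subset_insert _ _⟩

theorem mem_addL (A : Formula) (s : Sequent) : A ∈ (addL A s).1 := Finset.mem_insert_self _ _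

theorem mem_addR (A : Formula) (s : Sequent) : A ∈ (addR A s).2 := Finset.mem_insert_self _ _

namespace Candidate

variable {A : Formula} {X : Set Sequent}

theorem cutFree_addR (h : Candidate A X) {s : Sequent} (hs : s ∈ X) : CutFree (addR A s) :=
  h.right _ (mem_addR A s) (h.upper (le_addR A s) hs)

theorem cutFree_addL (h : Candidate A X) {s : Sequent} (hs : s ∈ compl X) : CutFree (addL A s) :=
  hs _ (le_addL A s) (h.left _ (mem_addL A s))

theorem mem_compl (h : Candidate A X) {s : Sequent} (hs : A ∈ s.2) : s ∈ compl X :=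
  fun t hst ht => h.right t (hst.2 hs) ht

/-- To belong to a candidate, it suffices that the formula can be discharged from antecedents. -/
theorem mem_of_forall (h : Candidate A X) {s : Sequent}
    (hs : ∀ t, s ≤ t → CutFree (addL A t) → CutFree t) : s ∈ X :=
  h.closed fun t hst ht => hs t hst (h.cutFree_addL ht)

/-- A right rule with principal formula in `s.2` supplies precisely this hypothesis. -/
theorem mem_compl_of_forall (h : Candidate A X) {s : Sequent}
    (hs : ∀ t, s ≤ t → CutFree (addR A t) → CutFree t) : s ∈ compl X :=
  fun t hst ht => hs t hst (h.cutFree_addR ht)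

end Candidate

theorem candidate_atom (n Y : ℕ) (t : Fin (n + 1) → ℕ) :
    Candidate (atom n Y t) (compl (compl {s | atom n Y t ∈ s.1})) where
  upper := isUpperSet_compl _
  closed := compl_compl_compl_subset (isUpperSet_compl _)
  left s hs := subset_compl_compl (fun _ _ h h' => h.1 h') hs
  right s hs h := by
    -- An extension of `s` with the atom in its antecedent has it on both sides, so it is an initial
    -- sequent.
    refine h s le_rfl fun u hu hu' => ?_
    have := Derivable.init (c := false) u.1 u.2 n Y t
    rwa [Finset.insert_eq_of_mem hu', Finset.insert_eq_of_mem (hu.2 hs)] at this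

/-! ### Values of formulas -/

/-- An interpretation of the second order variables. -/
abbrev Valuation : Type := (n : ℕ) → ℕ → (Fin (n + 1) → ℕ) → Set Sequent

/-- A predicate in every arity. -/
abbrev Pred : Type := (n : ℕ) → (Fin (n + 1) → ℕ) → Set Sequent

/-- The predicate consists, in arity `k + 1`, of candidates for the instances of some abstract. -/
def Pred.IsCandidate (k : ℕ) (f : Pred) : Prop :=
  ∃ T : Abstract k, ∀ t, Candidate (T.app t) (f k t)

/-- Interpret a new second order variable of arity `k + 1`. -/
def Valuation.push (k : ℕ) (f : Pred) (φ : Valuation) : Valuation := fun n i =>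
  if n = k then if i = 0 then f n else φ n (i - 1) else φ n i

/-- The value of a formula. -/
def value : Formula → (ℕ → ℕ) → Valuation → Set Sequent
  | atom n X t, ρ, φ => φ n X (fun j => ρ (t j))
  | neg F, ρ, φ => compl (value F ρ φ)
  | .or F G, ρ, φ => compl (compl (value F ρ φ) ∩ compl (value G ρ φ))
  | .and F G, ρ, φ => value F ρ φ ∩ value G ρ φ
  | ex0 F, ρ, φ => compl {s | ∀ a, s ∈ compl (value F (cons a ρ) φ)}
  | all0 F, ρ, φ => {s | ∀ a, s ∈ value F (cons a ρ) φ}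
  | ex1 k F, ρ, φ =>
    compl {s | ∀ f : Pred, f.IsCandidate k → s ∈ compl (value F ρ (φ.push k f))}
  | all1 k F, ρ, φ => {s | ∀ f : Pred, f.IsCandidate k → s ∈ value F ρ (φ.push k f)}

/-- The values of the second order variables are candidates for the instances of `σ`. -/
def Valuation.Realizes (φ : Valuation) (σ : Subst) : Prop :=
  ∀ n i t, Candidate ((σ n i).app t) (φ n i t)

theorem Valuation.Realizes.push {φ : Valuation} {σ : Subst} (h : φ.Realizes σ) {k : ℕ} {f : Pred}
    {T : Abstract k} (hT : ∀ t, Candidate (T.app t) (f k t)) :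
    (φ.push k f).Realizes (σ.push k T) := by
  intro n i t
  unfold Valuation.push Subst.push
  by_cases hn : n = k
  · subst hn
    by_cases hi : i = 0
    · simpa [hi] using hT t
    · simpa [hi] using h n (i - 1) t
  · simpa [hn] using h n i t

/-- The predicate given by a second order variable. -/
def varPred (Y : ℕ) : Pred := fun n t => compl (compl {s | atom n Y t ∈ s.1})

theorem candidate_varPred (n Y : ℕ) (t : Fin (n + 1) → ℕ) :
    Candidate ((Abstract.var n Y).app t) (varPred Y n t) := by
  rw [Abstract.app_var]
  exact candidate_atom n Y t

/-! ### The rules without cut, with absorbed principal formulas -/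

namespace CutFree

variable {s : Sequent} {F G : Formula} {n : ℕ}

theorem negL (h : neg F ∈ s.1) (h₁ : CutFree (addR F s)) : CutFree s := by
  have := Derivable.negL (c := false) s.1 s.2 F
  rw [Finset.insert_eq_of_mem h] at this
  exact this h₁

theorem negR (h : neg F ∈ s.2) (h₁ : CutFree (addL F s)) : CutFree s := by
  have := Derivable.negR (c := false) s.1 s.2 F
  rw [Finset.insert_eq_of_mem h] at this
  exact this h₁

theorem orL (h : Formula.or F G ∈ s.1) (h₁ : CutFree (addL F s)) (h₂ : CutFree (addL G s)) :
    CutFree s := by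
  have := Derivable.orL (c := false) s.1 s.2 F G
  rw [Finset.insert_eq_of_mem h] at this
  exact this h₁ h₂

theorem orR₀ (h : Formula.or F G ∈ s.2) (h₁ : CutFree (addR F s)) : CutFree s := by
  have := Derivable.orR₀ (c := false) s.1 s.2 F G
  rw [Finset.insert_eq_of_mem h] at this
  exact this h₁

theorem orR₁ (h : Formula.or F G ∈ s.2) (h₁ : CutFree (addR G s)) : CutFree s := by
  have := Derivable.orR₁ (c := false) s.1 s.2 F G
  rw [Finset.insert_eq_of_mem h] at this
  exact this h₁

theorem andL₀ (h : Formula.and F G ∈ s.1) (h₁ : CutFree (addL F s)) : CutFree s := by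
  have := Derivable.andL₀ (c := false) s.1 s.2 F G
  rw [Finset.insert_eq_of_mem h] at this
  exact this h₁

theorem andL₁ (h : Formula.and F G ∈ s.1) (h₁ : CutFree (addL G s)) : CutFree s := by
  have := Derivable.andL₁ (c := false) s.1 s.2 F G
  rw [Finset.insert_eq_of_mem h] at this
  exact this h₁

theorem andR (h : Formula.and F G ∈ s.2) (h₁ : CutFree (addR F s)) (h₂ : CutFree (addR G s)) :
    CutFree s := by
  have := Derivable.andR (c := false) s.1 s.2 F G
  rw [Finset.insert_eq_of_mem h] at this
  exact this h₁ h₂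

/-- Since the premise is assumed for all variables, one that is fresh for the finite sequent can be
chosen, and the eigenvariable condition disappears. -/
theorem ex0L (h : ex0 F ∈ s.1) (h₁ : ∀ a, CutFree (addL (inst0 F a) s)) : CutFree s := by
  obtain ⟨a, ha⟩ := exists_fresh Occurs0 exists_bound_occurs0 (s.1 ∪ s.2)
  have := Derivable.ex0L (c := false) s.1 s.2 F a
  rw [Finset.insert_eq_of_mem h] at this
  exact this ha (h₁ a)

theorem ex0R (h : ex0 F ∈ s.2) (t : ℕ) (h₁ : CutFree (addR (inst0 F t) s)) : CutFree s := by
  have := Derivable.ex0R (c := false) s.1 s.2 F t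
  rw [Finset.insert_eq_of_mem h] at this
  exact this h₁

theorem all0L (h : all0 F ∈ s.1) (t : ℕ) (h₁ : CutFree (addL (inst0 F t) s)) : CutFree s := by
  have := Derivable.all0L (c := false) s.1 s.2 F t
  rw [Finset.insert_eq_of_mem h] at this
  exact this h₁

theorem all0R (h : all0 F ∈ s.2) (h₁ : ∀ a, CutFree (addR (inst0 F a) s)) : CutFree s := by
  obtain ⟨a, ha⟩ := exists_fresh Occurs0 exists_bound_occurs0 (s.1 ∪ s.2)
  have := Derivable.all0R (c := false) s.1 s.2 F a
  rw [Finset.insert_eq_of_mem h] at this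
  exact this ha (h₁ a)

theorem ex1L (h : ex1 n F ∈ s.1)
    (h₁ : ∀ Y, CutFree (addL (inst1 F (Abstract.var n Y)) s)) : CutFree s := by
  obtain ⟨Y, hY⟩ := exists_fresh (Occurs1 n) (exists_bound_occurs1 n) (s.1 ∪ s.2)
  have := Derivable.ex1L (c := false) s.1 s.2 n F Y
  rw [Finset.insert_eq_of_mem h] at this
  exact this hY (h₁ Y)

theorem ex1R (h : ex1 n F ∈ s.2) (T : Abstract n) (h₁ : CutFree (addR (inst1 F T) s)) :
    CutFree s := by
  have := Derivable.ex1R (c := false) s.1 s.2 n F T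
  rw [Finset.insert_eq_of_mem h] at this
  exact this h₁

theorem all1L (h : all1 n F ∈ s.1) (T : Abstract n) (h₁ : CutFree (addL (inst1 F T) s)) :
    CutFree s := by
  have := Derivable.all1L (c := false) s.1 s.2 n F T
  rw [Finset.insert_eq_of_mem h] at this
  exact this h₁

theorem all1R (h : all1 n F ∈ s.2)
    (h₁ : ∀ Y, CutFree (addR (inst1 F (Abstract.var n Y)) s)) : CutFree s := by
  obtain ⟨Y, hY⟩ := exists_fresh (Occurs1 n) (exists_bound_occurs1 n) (s.1 ∪ s.2)
  have := Derivable.all1R (c := false) s.1 s.2 n F Y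
  rw [Finset.insert_eq_of_mem h] at this
  exact this hY (h₁ Y)

end CutFree

/-! ### Values of formulas are candidates -/

theorem compl_anti {X Y : Set Sequent} (h : X ⊆ Y) : compl Y ⊆ compl X :=
  fun _ hs t hst ht => hs t hst (h ht)

/-- The value of a formula is a candidate for the corresponding substitution instance. -/
theorem candidate_value (F : Formula) : ∀ {ρ : ℕ → ℕ} {φ : Valuation} {σ : Subst},
    φ.Realizes σ → Candidate (subst σ (rename0 ρ F)) (value F ρ φ) := by
  induction F with
  | atom n X t => intro ρ φ σ h; exact h n X (fun j => ρ (t j))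
  | neg F ih =>
    intro ρ φ σ h
    have hF := ih (ρ := ρ) h
    simp only [value, rename0, subst]
    exact ⟨isUpperSet_compl _, compl_compl_compl_subset hF.upper,
      fun s hs => hF.mem_compl_of_forall fun t hst ht => .negL (hst.1 hs) ht,
      fun s hs hs' => .negR hs (hF.cutFree_addL hs')⟩
  | or F G ihF ihG =>
    intro ρ φ σ h
    have hF := ihF (ρ := ρ) h
    have hG := ihG (ρ := ρ) h
    simp only [value, rename0, subst]
    refine ⟨isUpperSet_compl _,
      compl_compl_compl_subset ((isUpperSet_compl _).inter (isUpperSet_compl _)),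
      fun s hs t hst ht => .orL (hst.1 hs) (hF.cutFree_addL ht.1) (hG.cutFree_addL ht.2),
      fun s hs hs' => hs' s le_rfl ⟨?_, ?_⟩⟩
    · exact hF.mem_compl_of_forall fun t hst ht => .orR₀ (hst.2 hs) ht
    · exact hG.mem_compl_of_forall fun t hst ht => .orR₁ (hst.2 hs) ht
  | and F G ihF ihG =>
    intro ρ φ σ h
    have hF := ihF (ρ := ρ) h
    have hG := ihG (ρ := ρ) h
    simp only [value, rename0, subst]
    refine ⟨hF.upper.inter hG.upper, fun s hs => ⟨?_, ?_⟩, fun s hs => ⟨?_, ?_⟩,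
      fun s hs hs' => .andR hs (hF.cutFree_addR hs'.1) (hG.cutFree_addR hs'.2)⟩
    · exact hF.closed (compl_anti (compl_anti Set.inter_subset_left) hs)
    · exact hG.closed (compl_anti (compl_anti Set.inter_subset_right) hs)
    · exact hF.mem_of_forall fun t hst ht => .andL₀ (hst.1 hs) ht
    · exact hG.mem_of_forall fun t hst ht => .andL₁ (hst.1 hs) ht
  | ex0 F ih =>
    intro ρ φ σ h
    have hF := fun a => ih (ρ := cons a ρ) h
    -- Rewrites the formula in the induction hypothesis as the active formula of the first order
    -- rules.
    simp only [← inst0_subst_weaken0] at hF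
    simp only [value, rename0, subst]
    exact ⟨isUpperSet_compl _,
      compl_compl_compl_subset fun s t hst hs a => isUpperSet_compl _ hst (hs a),
      fun s hs t hst ht => .ex0L (hst.1 hs) fun a => (hF a).cutFree_addL (ht a),
      fun s hs hs' => hs' s le_rfl fun a =>
        (hF a).mem_compl_of_forall fun t hst ht => .ex0R (hst.2 hs) a ht⟩
  | all0 F ih =>
    intro ρ φ σ h
    have hF := fun a => ih (ρ := cons a ρ) h
    simp only [← inst0_subst_weaken0] at hF
    simp only [value, rename0, subst]
    exact ⟨fun s t hst hs a => (hF a).upper hst (hs a),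
      fun s hs a => (hF a).closed (compl_anti (compl_anti (Set.ofPred_subset_ofPred.2 fun _ h => h a)) hs),
      fun s hs a => (hF a).mem_of_forall fun t hst ht => .all0L (hst.1 hs) a ht,
      fun s hs hs' => .all0R hs fun a => (hF a).cutFree_addR (hs' a)⟩
  | ex1 k F ih =>
    intro ρ φ σ h
    have hF := fun (f : Pred) (T : Abstract k) (hT : ∀ t, Candidate (T.app t) (f k t)) =>
      ih (ρ := ρ) (h.push hT)
    simp only [← inst1_subst_lift1] at hF
    simp only [value, rename0, subst]
    exact ⟨isUpperSet_compl _,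
      compl_compl_compl_subset fun s t hst hs f hf => isUpperSet_compl _ hst (hs f hf),
      -- The eigenvariable `Y`, read as an abstract, has the candidates `varPred Y`, so it lies in
      -- the range of the quantifier.
      fun s hs t hst ht => .ex1L (hst.1 hs) fun Y =>
        (hF _ _ (candidate_varPred k Y)).cutFree_addL (ht _ ⟨_, candidate_varPred k Y⟩),
      -- The abstract `T` that comes with an admissible predicate is the one instantiated in the
      -- right rule.
      fun s hs hs' => hs' s le_rfl fun f ⟨T, hT⟩ =>
        (hF f T hT).mem_compl_of_forall fun t hst ht => .ex1R (hst.2 hs) T ht⟩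
  | all1 k F ih =>
    intro ρ φ σ h
    have hF := fun (f : Pred) (T : Abstract k) (hT : ∀ t, Candidate (T.app t) (f k t)) =>
      ih (ρ := ρ) (h.push hT)
    simp only [← inst1_subst_lift1] at hF
    simp only [value, rename0, subst]
    exact ⟨fun s t hst hs f ⟨T, hT⟩ => (hF f T hT).upper hst (hs f ⟨T, hT⟩),
      fun s hs f ⟨T, hT⟩ =>
        (hF f T hT).closed (compl_anti (compl_anti
          (Set.ofPred_subset_ofPred.2 fun _ h => h f ⟨T, hT⟩)) hs),
      fun s hs f ⟨T, hT⟩ => (hF f T hT).mem_of_forall fun t hst ht => .all1L (hst.1 hs) T ht,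
      fun s hs hs' => .all1R hs fun Y =>
        (hF _ _ (candidate_varPred k Y)).cutFree_addR (hs' _ ⟨_, candidate_varPred k Y⟩)⟩

/-! ### Values and substitution -/

/-- Needed for eigenvariables: reinterpreting one leaves the formulas in which it is not free
unchanged. -/
theorem value_congr (F : Formula) : ∀ {ρ ρ' : ℕ → ℕ} {φ φ' : Valuation},
    (∀ a, Occurs0 a F → ρ a = ρ' a) → (∀ n Y, Occurs1 n Y F → φ n Y = φ' n Y) →
    value F ρ φ = value F ρ' φ' := by
  have key0 : ∀ {F : Formula} {ρ ρ' : ℕ → ℕ} (b : ℕ), (∀ a, Occurs0 (a + 1) F → ρ a = ρ' a) →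
      ∀ a, Occurs0 a F → cons b ρ a = cons b ρ' a := by
    intro F ρ ρ' b h a ha
    cases a with
    | zero => rfl
    | succ a => exact h a ha
  have key1 : ∀ {F : Formula} {φ φ' : Valuation} (k : ℕ) (f : Pred),
      (∀ n Y, Occurs1 n (shift1 k n Y) F → φ n Y = φ' n Y) →
      ∀ n Y, Occurs1 n Y F → φ.push k f n Y = φ'.push k f n Y := by
    intro F φ φ' k f h n Y hY
    unfold Valuation.push
    by_cases hn : n = k
    · subst hn
      cases Y with
      | zero => simp
      | succ Y => simpa using h n Y (by simpa [shift1] using hY)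
    · simpa [hn] using h n Y (by simpa [shift1, hn] using hY)
  induction F with
  | atom n X t =>
    intro ρ ρ' φ φ' h0 h1
    simp only [value, h1 n X ⟨rfl, rfl⟩]
    congr 1
    funext j
    exact h0 _ ⟨j, rfl⟩
  | neg F ih =>
    intro ρ ρ' φ φ' h0 h1
    simp only [value, ih h0 h1]
  | or F G ihF ihG | and F G ihF ihG =>
    intro ρ ρ' φ φ' h0 h1
    simp only [value, ihF (fun a h => h0 a (.inl h)) (fun n Y h => h1 n Y (.inl h)),
      ihG (fun a h => h0 a (.inr h)) (fun n Y h => h1 n Y (.inr h))]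
  | ex0 F ih | all0 F ih =>
    intro ρ ρ' φ φ' h0 h1
    simp only [value, fun b => ih (key0 b h0) h1]
  | ex1 k F ih | all1 k F ih =>
    intro ρ ρ' φ φ' h0 h1
    simp only [value, fun f => ih h0 (key1 k f h1)]

theorem value_rename0 (F : Formula) : ∀ (f ρ : ℕ → ℕ) (φ : Valuation),
    value (rename0 f F) ρ φ = value F (fun i => ρ (f i)) φ := by
  induction F <;> intro f ρ φ <;> simp_all [value, rename0, cons_liftMap]

theorem value_rename1 (F : Formula) : ∀ (g : ℕ → ℕ → ℕ) (ρ : ℕ → ℕ) (φ : Valuation),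
    value (rename1 g F) ρ φ = value F ρ (fun n i => φ n (g n i)) := by
  have key : ∀ (k : ℕ) (f : Pred) (φ : Valuation) (g : ℕ → ℕ → ℕ),
      (fun n i => φ.push k f n (liftMap1 k g n i)) =
        Valuation.push k f (fun n i => φ n (g n i)) := by
    intro k f φ g
    funext n i
    unfold Valuation.push liftMap1 liftMap
    by_cases h : n = k
    · by_cases hi : i = 0 <;> simp [h, hi]
    · simp [h]
  induction F <;> intro g ρ φ <;> simp_all [value, rename1]

theorem value_weaken1 {n : ℕ} (G : Abstract n) (k : ℕ) (f : Pred) (ρ : ℕ → ℕ) (φ : Valuation) :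
    value (G.weaken1 k) ρ (φ.push k f) = value G ρ φ := by
  rw [Abstract.weaken1, value_rename1]
  congr 1
  funext m i
  unfold Valuation.push shift1
  by_cases h : m = k <;> simp [h]

theorem value_weaken0 {n : ℕ} (G : Abstract n) (t : Fin (n + 1) → ℕ) (a : ℕ) (ρ : ℕ → ℕ)
    (φ : Valuation) :
    value G.weaken0 (consTuple t (cons a ρ)) φ = value G (consTuple t ρ) φ := by
  rw [Abstract.weaken0, value_rename0, consTuple_liftMap]
  rfl

theorem value_subst (F : Formula) : ∀ (τ : Subst) (ρ : ℕ → ℕ) (φ : Valuation),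
    value (subst τ F) ρ φ = value F ρ (fun n i t => value (τ n i) (consTuple t ρ) φ) := by
  have key : ∀ (k : ℕ) (f : Pred) (τ : Subst) (ρ : ℕ → ℕ) (φ : Valuation),
      (fun n i t => value (τ.lift1 k n i) (consTuple t ρ) (φ.push k f)) =
        Valuation.push k f (fun n i t => value (τ n i) (consTuple t ρ) φ) := by
    intro k f τ ρ φ
    funext n i t
    unfold Subst.lift1
    by_cases h : n = k
    · by_cases hi : i = 0
      · simp [h, hi, Abstract.var, value, consTuple_fin, Valuation.push]
      · simp [h, hi, value_weaken1]
        simp [Valuation.push, h, hi]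
    · simp [h, value_weaken1]
      simp [Valuation.push, h]
  induction F with
  | atom n X t =>
    intro τ ρ φ
    change value (Abstract.app _ _) _ _ = _
    rw [Abstract.app_eq, value_rename0, comp_consTuple]
    rfl
  | _ => intro τ ρ φ; simp_all [value, subst, value_weaken0]

theorem value_inst0 (F : Formula) (a : ℕ) (ρ : ℕ → ℕ) (φ : Valuation) :
    value (inst0 F a) ρ φ = value F (cons (ρ a) ρ) φ := by
  rw [inst0_eq, value_rename0]
  congr 1
  funext i
  unfold cons
  split <;> rfl

/-- The predicate is written in every arity only to fit the type `Pred`; `push` reads it in arity `k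
+ 1` alone. -/
theorem value_inst1 {k : ℕ} (F : Formula) (T : Abstract k) (ρ : ℕ → ℕ) (φ : Valuation) :
    value (inst1 F T) ρ φ =
      value F ρ (φ.push k fun _ t => value T (consTuple t ρ) φ) := by
  rw [inst1, value_subst]
  congr 1
  funext n i t
  unfold Valuation.push
  by_cases h : n = k
  · by_cases hi : i = 0 <;> simp [h, hi, Abstract.var, value, consTuple_fin]
  · simp [h, Abstract.var, value, consTuple_fin]

/-! ### Soundness -/

/-- Every second order variable is interpreted by candidates for some abstract. -/
def Valuation.IsRealizable (φ : Valuation) : Prop := ∃ σ, φ.Realizes σ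

namespace Valuation.IsRealizable

variable {φ : Valuation}

theorem isUpperSet_value (h : φ.IsRealizable) (F : Formula) (ρ : ℕ → ℕ) :
    IsUpperSet (value F ρ φ) :=
  h.elim fun _ hσ => (candidate_value F hσ).upper

theorem value_closed (h : φ.IsRealizable) (F : Formula) (ρ : ℕ → ℕ) :
    compl (compl (value F ρ φ)) ⊆ value F ρ φ :=
  h.elim fun _ hσ => (candidate_value F hσ).closed

theorem push (h : φ.IsRealizable) {k : ℕ} {f : Pred} (hf : f.IsCandidate k) :
    (φ.push k f).IsRealizable :=
  h.elim fun σ hσ => hf.elim fun T hT => ⟨σ.push k T, hσ.push hT⟩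

/-- Comprehension: the predicate defined by an abstract is in the range of the second order
quantifiers. -/
theorem isCandidate_value (h : φ.IsRealizable) {k : ℕ} (T : Abstract k) (ρ : ℕ → ℕ) :
    Pred.IsCandidate k fun _ t => value T (consTuple t ρ) φ := by
  obtain ⟨σ, hσ⟩ := h
  -- The witness is `T` itself with its parameters replaced according to `ρ` and `σ`, both moved
  -- past the `k + 1` argument places.
  refine ⟨subst (σ.rename0 (· + (k + 1))) (rename0 (liftMap (k + 1) ρ) T), fun t => ?_⟩
  rw [app_subst_weaken]
  exact candidate_value T hσ

end Valuation.IsRealizable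

/-- Change the value of the second order variable `Y` of arity `n + 1`. -/
def Valuation.update (φ : Valuation) (n Y : ℕ) (f : Pred) : Valuation := fun m i =>
  if m = n ∧ i = Y then f m else φ m i

theorem Valuation.IsRealizable.update {φ : Valuation} (h : φ.IsRealizable) {n : ℕ} {f : Pred}
    (hf : f.IsCandidate n) (Y : ℕ) : (φ.update n Y f).IsRealizable := by
  obtain ⟨σ, hσ⟩ := h
  obtain ⟨T, hT⟩ := hf
  refine ⟨fun m i => if m = n ∧ i = Y then T else σ m i, fun m i t => ?_⟩
  unfold Valuation.update
  by_cases hm : m = n ∧ i = Y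
  · obtain ⟨rfl, rfl⟩ := hm
    simpa using hT t
  · simpa [hm] using hσ m i t

/-- The sequent `s` forces all formulas in `Γ` and the negations of all formulas in `Δ`. -/
structure Forces (ρ : ℕ → ℕ) (φ : Valuation) (s : Sequent) (Γ Δ : Cedent) : Prop where
  left : ∀ A ∈ Γ, s ∈ value A ρ φ
  right : ∀ A ∈ Δ, s ∈ compl (value A ρ φ)

namespace Forces

variable {ρ : ℕ → ℕ} {φ : Valuation} {s : Sequent} {Γ Δ : Cedent} {A : Formula}

theorem mono (h : Forces ρ φ s Γ Δ) (hφ : φ.IsRealizable) {t : Sequent} (hst : s ≤ t) :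
    Forces ρ φ t Γ Δ :=
  ⟨fun A hA => hφ.isUpperSet_value A ρ hst (h.left A hA),
    fun A hA => isUpperSet_compl _ hst (h.right A hA)⟩

theorem insert_left (h : Forces ρ φ s Γ Δ) (hA : s ∈ value A ρ φ) :
    Forces ρ φ s (insert A Γ) Δ :=
  ⟨fun _ hB => (Finset.mem_insert.1 hB).elim (fun e => e ▸ hA) (h.left _), h.right⟩

theorem insert_right (h : Forces ρ φ s Γ Δ) (hA : s ∈ compl (value A ρ φ)) :
    Forces ρ φ s Γ (insert A Δ) :=
  ⟨h.left, fun _ hB => (Finset.mem_insert.1 hB).elim (fun e => e ▸ hA) (h.right _)⟩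

theorem head_left (h : Forces ρ φ s (insert A Γ) Δ) : s ∈ value A ρ φ :=
  h.left _ (Finset.mem_insert_self _ _)

theorem head_right (h : Forces ρ φ s Γ (insert A Δ)) : s ∈ compl (value A ρ φ) :=
  h.right _ (Finset.mem_insert_self _ _)

theorem congr (h : Forces ρ φ s Γ Δ) {ρ' : ℕ → ℕ} {φ' : Valuation}
    (hv : ∀ B ∈ Γ ∪ Δ, value B ρ' φ' = value B ρ φ) : Forces ρ' φ' s Γ Δ :=
  ⟨fun A hA => (hv A (Finset.mem_union_left _ hA)).symm ▸ h.left A hA,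
    fun A hA => (hv A (Finset.mem_union_right _ hA)).symm ▸ h.right A hA⟩

theorem update0 (h : Forces ρ φ s Γ Δ) {a : ℕ} (ha : ∀ B ∈ Γ ∪ Δ, ¬ Occurs0 a B) (b : ℕ) :
    Forces (Function.update ρ a b) φ s Γ Δ :=
  h.congr fun B hB => value_congr B
    (fun c hc => Function.update_of_ne (fun e : c = a => ha B hB (e ▸ hc)) _ _) fun _ _ _ => rfl

theorem update1 (h : Forces ρ φ s Γ Δ) {n Y : ℕ} (hY : ∀ B ∈ Γ ∪ Δ, ¬ Occurs1 n Y B)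
    (f : Pred) : Forces ρ (φ.update n Y f) s Γ Δ :=
  h.congr fun B hB => value_congr B (fun _ _ => rfl) fun _ _ hZ =>
    if_neg fun ⟨hm, hZY⟩ => hY B hB (hm ▸ hZY ▸ hZ)

end Forces

theorem value_inst0_update {F : Formula} {a : ℕ} (ha : ¬ Occurs0 (a + 1) F) (b : ℕ) (ρ : ℕ → ℕ)
    (φ : Valuation) :
    value (inst0 F a) (Function.update ρ a b) φ = value F (cons b ρ) φ := by
  rw [value_inst0, Function.update_self]
  refine value_congr F (fun c hc => ?_) fun _ _ _ => rfl
  cases c with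
  | zero => rfl
  | succ c => exact Function.update_of_ne (fun e : c = a => ha (e ▸ hc)) _ _

/-- Below the quantifier the outer variable `Y` has index `Y + 1`. As it is absent there, updating
`Y` affects only the instantiated place. -/
theorem value_inst1_update {F : Formula} {n Y : ℕ} (hY : ¬ Occurs1 n (Y + 1) F) (f : Pred)
    (ρ : ℕ → ℕ) (φ : Valuation) :
    value (inst1 F (Abstract.var n Y)) ρ (φ.update n Y f) = value F ρ (φ.push n f) := by
  rw [value_inst1]
  refine value_congr F (fun _ _ => rfl) fun m i hi => ?_
  funext t
  unfold Valuation.push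
  by_cases hm : m = n
  · subst hm
    cases i with
    | zero => simp [Abstract.var, value, Valuation.update, consTuple_fin]
    | succ i =>
      have : i ≠ Y := fun e => hY (e ▸ hi)
      simp [Valuation.update, this]
  · simp [Valuation.update, hm]

/-- Soundness of classical logic for the forcing semantics. The valuation must be generalized in the
induction because eigenvariables are reinterpreted by arbitrary admissible values. -/
theorem Derivable.cutFree_of_forces {c : Bool} {Γ Δ : Cedent} (h : Derivable c Γ Δ) :
    ∀ {ρ : ℕ → ℕ} {φ : Valuation}, φ.IsRealizable → ∀ {s : Sequent}, Forces ρ φ s Γ Δ →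
      CutFree s := by
  induction h with
  | init Γ Δ n X t => intro ρ φ hφ s hs; exact hs.head_right s le_rfl hs.head_left
  | negL Γ Δ F _ ih => intro ρ φ hφ s hs; exact ih hφ (hs.insert_right hs.head_left)
  | negR Γ Δ F _ ih =>
    intro ρ φ hφ s hs
    exact ih hφ (hs.insert_left (hφ.value_closed F ρ hs.head_right))
  | orL Γ Δ F G _ _ ihF ihG =>
    intro ρ φ hφ s hs
    exact hs.head_left s le_rfl ⟨fun t hst ht => ihF hφ ((hs.mono hφ hst).insert_left ht),
      fun t hst ht => ihG hφ ((hs.mono hφ hst).insert_left ht)⟩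
  | orR₀ Γ Δ F G _ ih =>
    intro ρ φ hφ s hs
    -- The value of `F` is contained in that of the disjunction, so refuting the latter refutes the
    -- former.
    exact ih hφ (hs.insert_right (compl_anti
      ((subset_compl_compl (hφ.isUpperSet_value F ρ)).trans (compl_anti Set.inter_subset_left))
      hs.head_right))
  | orR₁ Γ Δ F G _ ih =>
    intro ρ φ hφ s hs
    exact ih hφ (hs.insert_right (compl_anti
      ((subset_compl_compl (hφ.isUpperSet_value G ρ)).trans (compl_anti Set.inter_subset_right))
      hs.head_right))
  | andL₀ Γ Δ F G _ ih => intro ρ φ hφ s hs; exact ih hφ (hs.insert_left hs.head_left.1)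
  | andL₁ Γ Δ F G _ ih => intro ρ φ hφ s hs; exact ih hφ (hs.insert_left hs.head_left.2)
  | andR Γ Δ F G _ _ ihF ihG =>
    intro ρ φ hφ s hs
    -- To refute `F`, take an extension forcing it; to refute `G` there, extend again. The last
    -- condition forces both, hence the conjunction, which `s` refutes.
    refine ihF hφ (hs.insert_right fun t hst ht => ?_)
    refine ihG hφ ((hs.mono hφ hst).insert_right fun u htu hu => ?_)
    exact hs.head_right u (hst.trans htu) ⟨hφ.isUpperSet_value F ρ htu ht, hu⟩
  | ex0L Γ Δ F a ha _ ih =>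
    intro ρ φ hφ s hs
    refine hs.head_left s le_rfl fun b t hst ht => ?_
    refine ih hφ (((hs.mono hφ hst).update0 ha b).insert_left ?_)
    rwa [value_inst0_update (ha (ex0 F) (by simp))]
  | ex0R Γ Δ F t _ ih =>
    intro ρ φ hφ s hs
    refine ih hφ (hs.insert_right ?_)
    rw [value_inst0]
    exact compl_anti ((subset_compl_compl (hφ.isUpperSet_value F _)).trans
      (compl_anti (Set.ofPred_subset_ofPred.2 fun _ hu => hu (ρ t)))) hs.head_right
  | all0L Γ Δ F t _ ih =>
    intro ρ φ hφ s hs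
    exact ih hφ (hs.insert_left ((value_inst0 F t ρ φ).symm ▸ hs.head_left (ρ t)))
  | all0R Γ Δ F a ha _ ih =>
    intro ρ φ hφ s hs
    -- By closure it suffices to show that any extension refuting the instance at `b` is provable
    -- without cut; the eigenvariable is then given the value `b`.
    refine hs.head_right s le_rfl fun b => hφ.value_closed F _ fun t hst ht => ?_
    refine ih hφ (((hs.mono hφ hst).update0 ha b).insert_right ?_)
    rwa [value_inst0_update (ha (all0 F) (by simp))]
  | ex1L Γ Δ n F Y hY _ ih =>
    intro ρ φ hφ s hs
    refine hs.head_left s le_rfl fun f hf t hst ht => ?_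
    refine ih (hφ.update hf Y) (((hs.mono hφ hst).update1 hY f).insert_left ?_)
    rwa [value_inst1_update (by simpa [Occurs1, shift1] using hY (ex1 n F) (by simp))]
  | ex1R Γ Δ n F T _ ih =>
    intro ρ φ hφ s hs
    refine ih hφ (hs.insert_right ?_)
    have hT := hφ.isCandidate_value T ρ
    rw [value_inst1]
    exact compl_anti ((subset_compl_compl ((hφ.push hT).isUpperSet_value F ρ)).trans
      (compl_anti (Set.ofPred_subset_ofPred.2 fun _ hu => hu _ hT))) hs.head_right
  | all1L Γ Δ n F T _ ih =>
    intro ρ φ hφ s hs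
    exact ih hφ (hs.insert_left
      ((value_inst1 F T ρ φ).symm ▸ hs.head_left _ (hφ.isCandidate_value T ρ)))
  | all1R Γ Δ n F Y hY _ ih =>
    intro ρ φ hφ s hs
    refine hs.head_right s le_rfl fun f hf => (hφ.push hf).value_closed F _ fun t hst ht => ?_
    refine ih (hφ.update hf Y) (((hs.mono hφ hst).update1 hY f).insert_right ?_)
    rwa [value_inst1_update (by simpa [Occurs1, shift1] using hY (all1 n F) (by simp))]
  | cut Γ Δ Γ₁ Δ₁ C _ _ _ ih₁ ih₂ =>
    intro ρ φ hφ s hs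
    have h₁ : Forces ρ φ s Γ Δ := ⟨fun A hA => hs.left A (Finset.mem_union_left _ hA),
      fun A hA => hs.right A (Finset.mem_union_left _ hA)⟩
    have h₂ : Forces ρ φ s Γ₁ Δ₁ := ⟨fun A hA => hs.left A (Finset.mem_union_right _ hA),
      fun A hA => hs.right A (Finset.mem_union_right _ hA)⟩
    -- The second premise says that every extension forcing `C` is provable without cut, so `s`
    -- refutes `C`, as the first premise requires.
    exact ih₁ hφ (h₁.insert_right fun t hst ht => ih₂ hφ ((h₂.mono hφ hst).insert_left ht))

end G1LC

/-! ### The Hauptsatz -/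

theorem mainTheorem1 (Γ Δ : G1LC.Cedent) (h : G1LC.Provable Γ Δ) :
    G1LC.CutFreeProvable Γ Δ := by
  have hσ : G1LC.Valuation.Realizes (fun n Y => G1LC.varPred Y n) G1LC.Subst.id :=
    fun n Y t => G1LC.candidate_varPred n Y t
  have hc (A : G1LC.Formula) := G1LC.candidate_value A (ρ := fun i => i) hσ
  -- Under the identity assignment and substitution, the value of `A` is a candidate for `A` itself.
  simp only [G1LC.Formula.rename0_id, G1LC.Formula.subst_id] at hc
  exact G1LC.Derivable.cutFree_of_forces h ⟨_, hσ⟩ (s := (Γ, Δ))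
    ⟨fun A hA => (hc A).left _ hA, fun A hA => (hc A).mem_compl hA⟩
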